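/- **Setting.** Let $E$ be a complex Hausdorff locally convex space, $E'$ its space of continuous linear functionals, and $cs(E)$ the set of continuous seminorms on $E$. For $p\in cs(E)$ let $E_p$ be the normed space $(E,p)/p^{-1}(0)$ and $\pi_p\colon E\to E_p$ the canonical surjection. A fundamental family is a (nonempty) directed set $D\subset cs(E)$ that generates the topology of $E$. A *holomorphy type* $\Theta$ on a normed space $X$ is a sequence of Banach spaces $(\mathcal P_\Theta(^mX),\|\cdot\|_\Theta)_{m\ge 0}$, where $\mathcal P_\Theta(^mX)$ is a linear subspace of the space of continuous $m$-homogeneous scalar polynomials on $X$, $\mathcal P_\Theta(^0X)=\mathbb C$ as a normed space, and there is $\sigma\ge 1$ such that for all $k\le m$, $a\in X$, $P\in\mathcal P_\Theta(^mX)$ we have $\hat d^kP(a)\in\mathcal P_\Theta(^kX)$ and $\|\frac1{k!}\hat d^kP(a)\|_\Theta\le\sigma^m\|P\|_\Theta\|a\|^{m-k}$. It is a *$\pi_1$-holomorphy type* if moreover the space $\mathcal P_f(^mX)$ spanned by the powers $\phi^m$, $\phi\in X'$, is contained and dense in $\mathcal P_\Theta(^mX)$ for every $m\ge 0$, and there is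 $K>0$ with $\|\phi^m b\|_\Theta\le K^m\|\phi\|^m|b|$ for all $m\ge1$, $\phi\in X'$, $b\in\mathbb C$. The space $\mathcal H_{\Theta b}(X)$ consists of the entire functions $f$ on $X$ with $\frac1{m!}\hat d^mf(0)\in\mathcal P_\Theta(^mX)$ for all $m$ and $\|\frac1{m!}\hat d^mf(0)\|_\Theta^{1/m}\to0$; its topology is generated by the seminorms $\|f\|_{\Theta,\rho}=\sum_{m\ge 0}\frac{\rho^m}{m!}\|\hat d^mf(0)\|_\Theta$, $\rho>0$. Let a holomorphy type $\Theta$ be given on every $E_p$, $p\in cs(E)$, such that the spaces $\mathcal H_{\Theta b}(E_p)$ form an inductive system: whenever $p\le Cq$ for some constant $C$, composition with the canonical map $E_q\to E_p$ carries $\mathcal H_{\Theta b}(E_p)$ into $\mathcal H_{\Theta b}(E_q)$. Let $$\mathcal H_{u\Theta b}(E)=\bigcup_{p\in cs(E)}\{f_p\circ\pi_p: f_p\in\mathcal H_{\Theta b}(E_p)\},$$ with the finest locally convex topology for which all the maps $\mathcal H_{\Theta b}(E_p)\to\mathcal H_{u\Theta b}(E)$, $f_p\mapsto f_p\circ\pi_p$,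 are continuous. A *convolution operator* on $\mathcal H_{u\Theta b}(E)$ is a continuous linear operator $L$ on it such that $L(\tau_af)=\tau_a(Lf)$ for all $f$ and all $a\in E$, where $(\tau_af)(x)=f(x-a)$; it is *nontrivial* if it is not a scalar multiple of the identity. Put $(\Gamma L)(f)=(Lf)(0)$, and $\mathcal B(T)(\phi)=T(e^\phi)$ for $T\in\mathcal H_{u\Theta b}(E)'$ and $\phi\in E'$ (when the hypothesis below holds, every $e^\phi$ belongs to $\mathcal H_{u\Theta b}(E)$). **Proposition.** Assume that there is a fundamental family $D\subset cs(E)$ such that $(\mathcal P_\Theta(^mE_p))_{m\ge 0}$ is a $\pi_1$-holomorphy type for every $p\in D$. Let $L$ be a nontrivial convolution operator on $\mathcal H_{u\Theta b}(E)$, and let $$V=\{\phi\in E':|\mathcal B(\Gamma L)(\phi)|<1\},\qquad W=\{\phi\in E':|\mathcal B(\Gamma L)(\phi)|>1\},$$ $$H_V=\operatorname{span}\{e^\phi:\phi\in V\},\qquad H_W=\operatorname{span}\{e^\phi:\phi\in W\}.$$ Then: (a) $H_V$ and $H_W$ are dense in $\mathcal H_{u\Theta b}(E)$. (b) $L^nf\to0$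 as $n\to\infty$ for every $f\in H_V$. (c) There is a unique linear map $S\colon H_W\to H_W$ with $S(e^\phi)=e^\phi/\mathcal B(\Gamma L)(\phi)$ for every $\phi\in W$, and $S^nf\to0$ as $n\to\infty$ for every $f\in H_W$. (d) $L(S(f))=f$ for every $f\in H_W$. -/

import Mathlib

open Filter Topology

noncomputable section

namespace UniformHolo

/-! ### Polynomials and Taylor coefficients on a normed space -/

section Normed

variable {X : Type*} [NormedAddCommGroup X] [NormedSpace ℂ X]

/-- `P` is a continuous `m`-homogeneous polynomial on `X`: the restriction to the diagonal of a
continuous `m`-linear form. -/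
def IsHomPoly (m : ℕ) (P : X → ℂ) : Prop :=
  ∃ A : ContinuousMultilinearMap ℂ (fun _ : Fin m => X) ℂ, ∀ x, P x = A fun _ => x

/-- The `m`-homogeneous polynomials of finite type: the span of the powers `φ ^ m` of
continuous linear functionals. -/
def finiteTypePoly (X : Type*) [NormedAddCommGroup X] [NormedSpace ℂ X] (m : ℕ) :
    Submodule ℂ (X → ℂ) :=
  Submodule.span ℂ (Set.range fun φ : X →L[ℂ] ℂ => fun x => φ x ^ m)

/-- The `m`-th term `(1 / m!) d̂ᵐ f(a)` of the Taylor series of `f` at `a`, as a polynomial. -/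
def taylorTerm (m : ℕ) (f : X → ℂ) (a : X) : X → ℂ :=
  fun x => ((m.factorial : ℂ))⁻¹ * iteratedFDeriv ℂ m f a fun _ => x

theorem taylorTerm_add (m : ℕ) {f g : X → ℂ} (hf : AnalyticOnNhd ℂ f Set.univ)
    (hg : AnalyticOnNhd ℂ g Set.univ) (a : X) :
    taylorTerm m (f + g) a = taylorTerm m f a + taylorTerm m g a := by
  ext x
  simp only [taylorTerm, Pi.add_apply]
  rw [iteratedFDeriv_add_apply (hf.contDiff).contDiffAt (hg.contDiff).contDiffAt]
  simp [mul_add]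

theorem taylorTerm_smul (m : ℕ) (c : ℂ) {f : X → ℂ} (hf : AnalyticOnNhd ℂ f Set.univ) (a : X) :
    taylorTerm m (c • f) a = c • taylorTerm m f a := by
  ext x
  simp only [taylorTerm, Pi.smul_apply]
  rw [iteratedFDeriv_const_smul_apply (hf.contDiff).contDiffAt]
  simp only [_root_.smul_apply, smul_eq_mul]
  ring

theorem taylorTerm_zero_fun (m : ℕ) (a : X) : taylorTerm m (0 : X → ℂ) a = 0 := by
  have := taylorTerm_smul m (0 : ℂ) (f := (0 : X → ℂ)) (fun _ _ => analyticAt_const) a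
  simpa using this

theorem taylorTerm_order_zero (f : X → ℂ) (a : X) : taylorTerm 0 f a = fun _ => f a := by
  ext x
  simp [taylorTerm]

theorem taylorTerm_exp (m : ℕ) (φ : X →L[ℂ] ℂ) :
    taylorTerm m (fun x => Complex.exp (φ x)) 0
      = ((m.factorial : ℂ))⁻¹ • fun x => φ x ^ m := by
  ext x
  have h := φ.iteratedFDeriv_comp_right (f := Complex.exp) (Complex.contDiff_exp (n := m)) 0
    (i := m) le_rfl
  have h2 : (fun x => Complex.exp (φ x)) = Complex.exp ∘ φ := rfl
  simp only [taylorTerm, h2, h, ContinuousMultilinearMap.compContinuousLinearMap_apply,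
    iteratedFDeriv_apply_eq_iteratedDeriv_mul_prod, Pi.smul_apply, smul_eq_mul]
  simp [iteratedDeriv_eq_iterate, Complex.iter_deriv_exp]

end Normed

/-- The root condition `a m ^ (1 / m) → 0` means that `∑ ρ ^ m * a m` converges for all `ρ > 0`. -/
theorem root_tendsto_iff {a : ℕ → ℝ} (ha : ∀ m, 0 ≤ a m) :
    Tendsto (fun m : ℕ => a m ^ (1 / (m : ℝ))) atTop (𝓝 0) ↔
      ∀ ρ : ℝ, 0 < ρ → Summable fun m => ρ ^ m * a m := by
  constructor
  · intro h ρ hρ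
    have h1 : ∀ᶠ m : ℕ in atTop, a m ^ (1 / (m : ℝ)) < 1 / (2 * ρ) :=
      h.eventually (gt_mem_nhds (by positivity))
    refine Summable.of_norm_bounded_eventually_nat
      (g := fun m : ℕ => ((1 : ℝ) / 2) ^ m) (summable_geometric_of_lt_one (by norm_num)
        (by norm_num)) ?_
    filter_upwards [h1, eventually_gt_atTop 0] with m hm hm0
    have hm' : (m : ℝ) ≠ 0 := by exact_mod_cast hm0.ne'
    have e : a m = (a m ^ (1 / (m : ℝ))) ^ m := by
      rw [← Real.rpow_natCast, ← Real.rpow_mul (ha m), one_div_mul_cancel hm', Real.rpow_one]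
    rw [Real.norm_of_nonneg (mul_nonneg (pow_nonneg hρ.le _) (ha m)), e, ← mul_pow]
    refine pow_le_pow_left₀ (mul_nonneg hρ.le (Real.rpow_nonneg (ha m) _)) ?_ m
    calc ρ * a m ^ (1 / (m : ℝ)) ≤ ρ * (1 / (2 * ρ)) := mul_le_mul_of_nonneg_left hm.le hρ.le
      _ = 1 / 2 := by field_simp
  · intro h
    rw [Metric.tendsto_atTop']
    intro ε hε
    have h1 := (h (2 / ε) (by positivity)).tendsto_atTop_zero
    have h2 : ∀ᶠ m : ℕ in atTop, (2 / ε) ^ m * a m < 1 := h1.eventually (gt_mem_nhds one_pos)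
    obtain ⟨N, hN⟩ := eventually_atTop.1 h2
    refine ⟨N, fun m hm => ?_⟩
    have hm' : (m : ℝ) ≠ 0 := by
      have : 0 < m := by omega
      exact_mod_cast this.ne'
    have h3 := hN m hm.le
    have h4 : a m ≤ (ε / 2) ^ m := by
      have : (2 / ε) ^ m * (ε / 2) ^ m = 1 := by
        rw [← mul_pow]
        have : 2 / ε * (ε / 2) = 1 := by field_simp
        rw [this, one_pow]
      have hp : 0 < (2 / ε) ^ m := by positivity
      nlinarith
    rw [Real.dist_eq, sub_zero, abs_of_nonneg (Real.rpow_nonneg (ha m) _)]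
    calc a m ^ (1 / (m : ℝ)) ≤ ((ε / 2) ^ m) ^ (1 / (m : ℝ)) :=
          Real.rpow_le_rpow (ha m) h4 (by positivity)
      _ = ε / 2 := by
          rw [← Real.rpow_natCast, ← Real.rpow_mul (by positivity), mul_one_div_cancel hm',
            Real.rpow_one]
      _ < ε := by linarith

/-! ### Holomorphy types on a normed space -/

/-- A (scalar-valued) holomorphy type on the normed space `X`: a sequence of Banach spaces
`carrier m` of continuous `m`-homogeneous polynomials, with norms `nrm m` (only the values of
`nrm m` on `carrier m` matter). -/
structure HolomorphyType (X : Type*) [NormedAddCommGroup X] [NormedSpace ℂ X] where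
  /-- the space `P_Θ(ᵐX)` -/
  carrier : ℕ → Submodule ℂ (X → ℂ)
  /-- the norm of `P_Θ(ᵐX)` -/
  nrm : ℕ → (X → ℂ) → ℝ
  isHomPoly : ∀ m, ∀ P ∈ carrier m, IsHomPoly m P
  nrm_add_le : ∀ m, ∀ P ∈ carrier m, ∀ Q ∈ carrier m, nrm m (P + Q) ≤ nrm m P + nrm m Q
  nrm_smul : ∀ m, ∀ c : ℂ, ∀ P ∈ carrier m, nrm m (c • P) = ‖c‖ * nrm m P
  eq_zero_of_nrm : ∀ m, ∀ P ∈ carrier m, nrm m P = 0 → P = 0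
  complete : ∀ m, ∀ u : ℕ → X → ℂ, (∀ n, u n ∈ carrier m) →
    (∀ ε > 0, ∃ N, ∀ i ≥ N, ∀ j ≥ N, nrm m (u i - u j) < ε) →
    ∃ P ∈ carrier m, Tendsto (fun n => nrm m (u n - P)) atTop (𝓝 0)
  mem_carrier_zero : ∀ P, IsHomPoly 0 P → P ∈ carrier 0
  nrm_zero_eq : ∀ P ∈ carrier 0, nrm 0 P = ‖P 0‖
  derivative_bound : ∃ σ : ℝ, 1 ≤ σ ∧ ∀ k m : ℕ, k ≤ m → ∀ a : X, ∀ P ∈ carrier m,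
    taylorTerm k P a ∈ carrier k ∧
      nrm k (taylorTerm k P a) ≤ σ ^ m * nrm m P * ‖a‖ ^ (m - k)

namespace HolomorphyType

variable {X : Type*} [NormedAddCommGroup X] [NormedSpace ℂ X] (Θ : HolomorphyType X)

theorem nrm_zero (m : ℕ) : Θ.nrm m 0 = 0 := by
  simpa using Θ.nrm_smul m 0 0 (Θ.carrier m).zero_mem

theorem nrm_nonneg {m : ℕ} {P : X → ℂ} (hP : P ∈ Θ.carrier m) : 0 ≤ Θ.nrm m P := by
  have h1 := Θ.nrm_add_le m P hP ((-1 : ℂ) • P) ((Θ.carrier m).smul_mem _ hP)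
  rw [Θ.nrm_smul m _ P hP] at h1
  have h2 : P + (-1 : ℂ) • P = 0 := by simp
  rw [h2, Θ.nrm_zero] at h1
  simp at h1
  linarith

/-- A holomorphy type is a `π₁`-holomorphy type if it contains the polynomials of finite type, with
`‖φᵐ b‖_Θ ≤ Kᵐ ‖φ‖ᵐ ‖b‖`, and they are dense. -/
structure IsPi1 : Prop where
  finiteType_le : ∀ m, finiteTypePoly X m ≤ Θ.carrier m
  bound : ∃ K : ℝ, 0 < K ∧ ∀ m : ℕ, 1 ≤ m → ∀ (φ : X →L[ℂ] ℂ) (b : ℂ),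
    Θ.nrm m (fun x => φ x ^ m * b) ≤ K ^ m * ‖φ‖ ^ m * ‖b‖
  dense : ∀ m, ∀ P ∈ Θ.carrier m, ∀ ε > 0, ∃ Q ∈ finiteTypePoly X m, Θ.nrm m (P - Q) < ε

/-- `f` is an entire function of `Θ`-bounded type. -/
structure IsBoundedType (f : X → ℂ) : Prop where
  analytic : AnalyticOnNhd ℂ f Set.univ
  mem : ∀ m, taylorTerm m f 0 ∈ Θ.carrier m
  root : Tendsto (fun m : ℕ => Θ.nrm m (taylorTerm m f 0) ^ (1 / (m : ℝ))) atTop (𝓝 0)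

variable {Θ}

theorem IsBoundedType.summable {f : X → ℂ} (hf : Θ.IsBoundedType f) {ρ : ℝ} (hρ : 0 < ρ) :
    Summable fun m => ρ ^ m * Θ.nrm m (taylorTerm m f 0) :=
  (root_tendsto_iff fun m => Θ.nrm_nonneg (hf.mem m)).1 hf.root ρ hρ

theorem isBoundedType_of_summable {f : X → ℂ} (h1 : AnalyticOnNhd ℂ f Set.univ)
    (h2 : ∀ m, taylorTerm m f 0 ∈ Θ.carrier m)
    (h3 : ∀ ρ : ℝ, 0 < ρ → Summable fun m => ρ ^ m * Θ.nrm m (taylorTerm m f 0)) :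
    Θ.IsBoundedType f :=
  ⟨h1, h2, (root_tendsto_iff fun m => Θ.nrm_nonneg (h2 m)).2 h3⟩

variable (Θ)

/-- The vector space of entire functions of `Θ`-bounded type, as a subspace of all functions. -/
def boundedTypeSubmodule : Submodule ℂ (X → ℂ) where
  carrier := {f | Θ.IsBoundedType f}
  zero_mem' := by
    refine isBoundedType_of_summable (fun _ _ => analyticAt_const) (fun m => ?_) fun ρ _ => ?_
    · rw [taylorTerm_zero_fun]; exact (Θ.carrier m).zero_mem
    · simp only [taylorTerm_zero_fun, nrm_zero, mul_zero]; exact summable_zero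
  add_mem' := by
    intro f g hf hg
    have h2 : ∀ m, taylorTerm m (f + g) 0 ∈ Θ.carrier m := fun m => by
      rw [taylorTerm_add m hf.analytic hg.analytic]
      exact (Θ.carrier m).add_mem (hf.mem m) (hg.mem m)
    refine isBoundedType_of_summable (hf.analytic.add hg.analytic) h2 fun ρ hρ => ?_
    refine Summable.of_nonneg_of_le (fun m => mul_nonneg (by positivity) (Θ.nrm_nonneg (h2 m)))
      (fun m => ?_) ((hf.summable hρ).add (hg.summable hρ))
    rw [taylorTerm_add m hf.analytic hg.analytic, ← mul_add]
    exact mul_le_mul_of_nonneg_left (Θ.nrm_add_le m _ (hf.mem m) _ (hg.mem m)) (by positivity)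
  smul_mem' := by
    intro c f hf
    refine isBoundedType_of_summable (fun x hx => analyticAt_const.smul (hf.analytic x hx))
      (fun m => ?_) fun ρ hρ => ?_
    · rw [taylorTerm_smul m c hf.analytic]
      exact (Θ.carrier m).smul_mem _ (hf.mem m)
    · have : (fun m => ρ ^ m * Θ.nrm m (taylorTerm m (c • f) 0))
          = fun m => ‖c‖ * (ρ ^ m * Θ.nrm m (taylorTerm m f 0)) := by
        ext m
        rw [taylorTerm_smul m c hf.analytic, Θ.nrm_smul m _ _ (hf.mem m)]
        ring
      rw [this]
      exact (hf.summable hρ).mul_left _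

/-- The space `H_{Θb}(X)` (a type of its own, so that it does not inherit the topology of
pointwise convergence). -/
def BoundedType : Type _ := Θ.boundedTypeSubmodule

instance : AddCommGroup Θ.BoundedType := inferInstanceAs (AddCommGroup Θ.boundedTypeSubmodule)
instance : Module ℂ Θ.BoundedType := inferInstanceAs (Module ℂ Θ.boundedTypeSubmodule)

/-- An element of `H_{Θb}(X)` as a function, linearly. -/
def toFunₗ : Θ.BoundedType →ₗ[ℂ] (X → ℂ) := Θ.boundedTypeSubmodule.subtype

instance : CoeFun Θ.BoundedType fun _ => X → ℂ := ⟨fun f => Θ.toFunₗ f⟩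

theorem isBoundedType_coe (f : Θ.BoundedType) : Θ.IsBoundedType f := f.2

/-- The seminorm `‖f‖_{Θ,ρ} = ∑ ρᵐ ‖(1 / m!) d̂ᵐ f(0)‖_Θ` on `H_{Θb}(X)`. -/
def rhoSeminorm (ρ : {ρ : ℝ // 0 < ρ}) : Seminorm ℂ Θ.BoundedType :=
  Seminorm.of (fun f => ∑' m : ℕ, ρ.1 ^ m * Θ.nrm m (taylorTerm m f 0))
    (by
      intro f g
      have hf := Θ.isBoundedType_coe f
      have hg := Θ.isBoundedType_coe g
      have hfg := Θ.isBoundedType_coe (f + g)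
      rw [← (hf.summable ρ.2).tsum_add (hg.summable ρ.2)]
      refine (hfg.summable ρ.2).tsum_le_tsum (fun m => ?_)
        ((hf.summable ρ.2).add (hg.summable ρ.2))
      rw [map_add, taylorTerm_add m hf.analytic hg.analytic, ← mul_add]
      exact mul_le_mul_of_nonneg_left (Θ.nrm_add_le m _ (hf.mem m) _ (hg.mem m))
        (pow_nonneg ρ.2.le _))
    (by
      intro c f
      have hf := Θ.isBoundedType_coe f
      rw [← tsum_mul_left]
      refine tsum_congr fun m => ?_
      rw [map_smul, taylorTerm_smul m c hf.analytic, Θ.nrm_smul m _ _ (hf.mem m)]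
      ring)

/-- The locally convex topology of `H_{Θb}(X)`, generated by the seminorms `‖·‖_{Θ,ρ}`, `ρ > 0`. -/
instance : TopologicalSpace Θ.BoundedType :=
  (SeminormFamily.moduleFilterBasis (𝕜 := ℂ) Θ.rhoSeminorm).topology

theorem withSeminorms : WithSeminorms (𝕜 := ℂ) Θ.rhoSeminorm := ⟨rfl⟩

theorem continuous_eval_zero : Continuous fun f : Θ.BoundedType => f 0 := by
  have hT := Θ.withSeminorms.topologicalAddGroup
  let e : Θ.BoundedType →ₗ[ℂ] ℂ := (LinearMap.proj (0 : X)).comp Θ.toFunₗ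
  change Continuous e
  refine WithSeminorms.continuous_of_isBounded Θ.withSeminorms (norm_withSeminorms ℂ ℂ) e ?_
  refine fun _ => ⟨{⟨1, one_pos⟩}, 1, fun f => ?_⟩
  have hf := Θ.isBoundedType_coe f
  have h0 := (hf.summable (ρ := 1) one_pos).le_tsum 0
    fun m _ => mul_nonneg (by positivity) (Θ.nrm_nonneg (hf.mem m))
  have h1 := Θ.nrm_zero_eq _ (hf.mem 0)
  rw [taylorTerm_order_zero] at h1
  rw [taylorTerm_order_zero, h1] at h0
  have h2 : Θ.rhoSeminorm ⟨1, one_pos⟩ f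
      = ∑' m : ℕ, (1 : ℝ) ^ m * Θ.nrm m (taylorTerm m f 0) := rfl
  simpa [h2, e] using h0

variable {Θ}

/-- Exponentials of continuous functionals are of `Θ`-bounded type if `Θ` is a `π₁`-type. -/
theorem IsPi1.isBoundedType_exp (h : Θ.IsPi1) (φ : X →L[ℂ] ℂ) :
    Θ.IsBoundedType fun x => Complex.exp (φ x) := by
  have hmem : ∀ m, (fun x => φ x ^ m) ∈ Θ.carrier m := fun m =>
    h.finiteType_le m (Submodule.subset_span ⟨φ, rfl⟩)
  have hmem' : ∀ m, taylorTerm m (fun x => Complex.exp (φ x)) 0 ∈ Θ.carrier m := fun m => by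
    rw [taylorTerm_exp]; exact (Θ.carrier m).smul_mem _ (hmem m)
  obtain ⟨K, hK, hb⟩ := h.bound
  refine isBoundedType_of_summable (fun x _ => (φ.analyticAt x).cexp) hmem' fun ρ hρ => ?_
  refine Summable.of_norm_bounded_eventually_nat
    (Real.summable_pow_div_factorial (ρ * K * ‖φ‖)) ?_
  filter_upwards [eventually_ge_atTop 1] with m hm
  rw [Real.norm_of_nonneg (mul_nonneg (by positivity) (Θ.nrm_nonneg (hmem' m))), taylorTerm_exp,
    Θ.nrm_smul m _ _ (hmem m)]
  have h1 := hb m hm φ 1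
  simp only [mul_one, norm_one] at h1
  have h2 : ‖((m.factorial : ℂ))⁻¹‖ = ((m.factorial : ℝ))⁻¹ := by simp
  rw [h2, div_eq_mul_inv, mul_pow, mul_pow]
  calc ρ ^ m * (((m.factorial : ℝ))⁻¹ * Θ.nrm m fun x => φ x ^ m)
      ≤ ρ ^ m * (((m.factorial : ℝ))⁻¹ * (K ^ m * ‖φ‖ ^ m)) := by gcongr
    _ = _ := by ring

end HolomorphyType

/-! ### Locally convex spaces and the normed spaces `E_p` -/

section LocallyConvex

variable {E : Type*} [AddCommGroup E] [Module ℂ E] [TopologicalSpace E]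

variable (E) in
/-- `cs(E)`: the continuous seminorms on `E`. -/
def ContSeminorm : Type _ := {p : Seminorm ℂ E // Continuous p}

instance : CoeFun (ContSeminorm E) fun _ => E → ℝ := ⟨fun p => p.1⟩

/-- A fundamental family: a directed set of continuous seminorms that generates the topology. -/
structure IsFundamentalFamily (D : Set (ContSeminorm E)) : Prop where
  nonempty : D.Nonempty
  directed : ∀ p ∈ D, ∀ q ∈ D, ∃ r ∈ D, p.1 ≤ r.1 ∧ q.1 ≤ r.1
  generates : WithSeminorms (𝕜 := ℂ) fun p : D => p.1.1

/-- The space `E` with the seminorm `p`. -/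
def Seminormed (_p : ContSeminorm E) : Type _ := E

instance (p : ContSeminorm E) : SeminormedAddCommGroup (Seminormed p) :=
  AddGroupSeminorm.toSeminormedAddCommGroup (E := E) p.1.toAddGroupSeminorm

instance (p : ContSeminorm E) : Module ℂ (Seminormed p) := inferInstanceAs (Module ℂ E)

instance (p : ContSeminorm E) : NormedSpace ℂ (Seminormed p) where
  norm_smul_le c x := (map_smul_eq_mul p.1 c x).le

/-- The normed space `E_p = (E, p) / p⁻¹(0)`. -/
abbrev LocalSpace (p : ContSeminorm E) : Type _ := SeparationQuotient (Seminormed p)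

/-- The canonical surjection `π_p : E → E_p`. -/
def proj (p : ContSeminorm E) : E →ₗ[ℂ] LocalSpace p :=
  ((SeparationQuotient.mkCLM ℂ (Seminormed p) : Seminormed p →L[ℂ] LocalSpace p) :
    Seminormed p →ₗ[ℂ] LocalSpace p)

theorem norm_proj (p : ContSeminorm E) (x : E) : ‖proj p x‖ = p x :=
  SeparationQuotient.norm_mk (id x : Seminormed p)

theorem proj_surjective (p : ContSeminorm E) : Function.Surjective (proj p) :=
  fun y => (SeparationQuotient.surjective_mk y : ∃ x : Seminormed p, SeparationQuotient.mk x = y)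

variable (E) in
/-- A holomorphy type `Θ` on the spaces `E_p`, `p ∈ cs(E)`, for which the spaces `H_{Θb}(E_p)` form
an inductive system: if `p ≤ C q`, then composition with the canonical map `E_q → E_p` carries
`H_{Θb}(E_p)` into `H_{Θb}(E_q)`. -/
structure HolomorphySystem where
  /-- the holomorphy type `(P_Θ(ᵐE_p))ₘ` -/
  type : ∀ p : ContSeminorm E, HolomorphyType (LocalSpace p)
  mono : ∀ p q : ContSeminorm E, (∃ C : ℝ, ∀ x, p x ≤ C * q x) →
    ∀ f : LocalSpace p → ℂ, (type p).IsBoundedType f →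
      ∃ g : LocalSpace q → ℂ, (type q).IsBoundedType g ∧ ∀ x, g (proj q x) = f (proj p x)

namespace HolomorphySystem

variable (Θ : HolomorphySystem E)

/-- `f` is of uniform `Θ`-bounded type: `f = f_p ∘ π_p` with `p ∈ cs(E)`, `f_p ∈ H_{Θb}(E_p)`.
Such a function is automatically holomorphic on `E`. -/
def IsUniform (f : E → ℂ) : Prop :=
  ∃ (p : ContSeminorm E) (g : LocalSpace p → ℂ), (Θ.type p).IsBoundedType g ∧ f = g ∘ proj p

/-- The functions of uniform `Θ`-bounded type, as a subspace of all functions. -/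
def uniformSubmodule : Submodule ℂ (E → ℂ) where
  carrier := {f | Θ.IsUniform f}
  zero_mem' :=
    let o : ContSeminorm E := ⟨0, continuous_const⟩
    ⟨o, 0, (Θ.type o).boundedTypeSubmodule.zero_mem, rfl⟩
  add_mem' := by
    rintro f g ⟨p, f', hf, rfl⟩ ⟨q, g', hg, rfl⟩
    let r : ContSeminorm E := ⟨p.1 + q.1, p.2.add q.2⟩
    have hr : ∀ x, r x = p x + q x := fun x => rfl
    obtain ⟨f'', hf'', hfe⟩ := Θ.mono p r
      ⟨1, fun x => by rw [one_mul, hr]; linarith [apply_nonneg q.1 x]⟩ f' hf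
    obtain ⟨g'', hg'', hge⟩ := Θ.mono q r
      ⟨1, fun x => by rw [one_mul, hr]; linarith [apply_nonneg p.1 x]⟩ g' hg
    refine ⟨r, f'' + g'', (Θ.type r).boundedTypeSubmodule.add_mem hf'' hg'', ?_⟩
    ext x
    simp [hfe, hge]
  smul_mem' := by
    rintro c f ⟨p, f', hf, rfl⟩
    exact ⟨p, c • f', (Θ.type p).boundedTypeSubmodule.smul_mem c hf, rfl⟩

/-- The space `H_{uΘb}(E)` (a type of its own, so that it does not inherit the topology of
pointwise convergence). -/
def Uniform : Type _ := Θ.uniformSubmodule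

instance : AddCommGroup Θ.Uniform := inferInstanceAs (AddCommGroup Θ.uniformSubmodule)
instance : Module ℂ Θ.Uniform := inferInstanceAs (Module ℂ Θ.uniformSubmodule)

/-- An element of `H_{uΘb}(E)` as a function, linearly. -/
def toFunₗ : Θ.Uniform →ₗ[ℂ] (E → ℂ) := Θ.uniformSubmodule.subtype

instance : CoeFun Θ.Uniform fun _ => E → ℂ := ⟨fun f => Θ.toFunₗ f⟩

/-- The map `π_p^* : H_{Θb}(E_p) → H_{uΘb}(E)`, `f ↦ f ∘ π_p`. -/
def pullback (p : ContSeminorm E) : (Θ.type p).BoundedType →ₗ[ℂ] Θ.Uniform where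
  toFun f := ⟨f ∘ proj p, p, f, (Θ.type p).isBoundedType_coe f, rfl⟩
  map_add' _ _ := rfl
  map_smul' _ _ := rfl

/-- The locally convex inductive topology of `H_{uΘb}(E)`: the finest locally convex vector space
topology for which all the maps `π_p^*` are continuous. -/
instance : TopologicalSpace Θ.Uniform :=
  sInf {t | @IsTopologicalAddGroup _ t _ ∧ @ContinuousSMul ℂ _ _ _ t ∧
    @LocallyConvexSpace ℝ _ _ _ _ _ t ∧ ∀ p, @Continuous _ _ _ t (Θ.pullback p)}

instance : IsTopologicalAddGroup Θ.Uniform := topologicalAddGroup_sInf fun _ ht => ht.1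
instance : ContinuousSMul ℂ Θ.Uniform := continuousSMul_sInf fun _ ht => ht.2.1
instance : LocallyConvexSpace ℝ Θ.Uniform := LocallyConvexSpace.sInf fun _ ht => ht.2.2.1

theorem continuous_pullback (p : ContSeminorm E) : Continuous (Θ.pullback p) :=
  continuous_sInf_rng.2 fun _ ht => ht.2.2.2 p

/-- Evaluation at `0`, a continuous linear form on `H_{uΘb}(E)`. -/
def evalZero : Θ.Uniform →L[ℂ] ℂ where
  toLinearMap := (LinearMap.proj (0 : E)).comp Θ.toFunₗ
  cont := by
    let e : Θ.Uniform →ₗ[ℂ] ℂ := (LinearMap.proj (0 : E)).comp Θ.toFunₗ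
    change Continuous e
    rw [continuous_iff_le_induced]
    refine sInf_le ⟨topologicalAddGroup_induced e, continuousSMul_induced e,
      LocallyConvexSpace.induced (e.restrictScalars ℝ), fun p => ?_⟩
    rw [continuous_induced_rng]
    have h : (e ∘ Θ.pullback p) = fun f : (Θ.type p).BoundedType => f 0 := by
      ext f
      change f (proj p 0) = f 0
      rw [map_zero]
    rw [h]
    exact (Θ.type p).continuous_eval_zero

/-- A convolution operator on `H_{uΘb}(E)`: a continuous linear operator that commutes with the
translations `(τ_a f)(x) = f (x - a)`; here `g` stands for `τ_a f`. -/
def IsConvolution (L : Θ.Uniform →L[ℂ] Θ.Uniform) : Prop :=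
  ∀ (a : E) (f g : Θ.Uniform), (∀ x, g x = f (x - a)) → ∀ x, L g x = L f (x - a)

/-- The functional `Γ L : f ↦ (L f)(0)`. -/
def Gam (L : Θ.Uniform →L[ℂ] Θ.Uniform) : Θ.Uniform →L[ℂ] ℂ := Θ.evalZero.comp L

/-- There is a fundamental family of seminorms `p` for which `(P_Θ(ᵐE_p))ₘ` is a
`π₁`-holomorphy type. -/
def HasPi1Family : Prop :=
  ∃ D : Set (ContSeminorm E), IsFundamentalFamily D ∧ ∀ p ∈ D, (Θ.type p).IsPi1

end HolomorphySystem

/-- Every continuous linear functional on `E` factors through some `E_p` with `p` in a given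
fundamental family. -/
theorem IsFundamentalFamily.exists_factor {D : Set (ContSeminorm E)} (hD : IsFundamentalFamily D)
    (φ : E →L[ℂ] ℂ) :
    ∃ p ∈ D, ∃ ψ : LocalSpace p →L[ℂ] ℂ, ∀ x, ψ (proj p x) = φ x := by
  have := hD.generates.topologicalAddGroup
  have hφ : Continuous ((normSeminorm ℂ ℂ).comp (φ : E →ₗ[ℂ] ℂ)) := φ.continuous.norm
  obtain ⟨s, C, _, hs⟩ := Seminorm.bound_of_continuous hD.generates _ hφ
  have hdir : ∃ r ∈ D, ∀ p ∈ s, (p : ContSeminorm E).1 ≤ r.1 := by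
    classical
    clear hs
    induction s using Finset.induction_on with
    | empty =>
      obtain ⟨r, hr⟩ := hD.nonempty
      exact ⟨r, hr, by simp⟩
    | insert a t _ ih =>
      obtain ⟨r, hr, h⟩ := ih
      obtain ⟨r', hr', h1, h2⟩ := hD.directed a.1 a.2 r hr
      refine ⟨r', hr', fun p hp => ?_⟩
      rcases Finset.mem_insert.1 hp with rfl | hp
      · exact h1
      · exact (h p hp).trans h2
  obtain ⟨r, hr, hrs⟩ := hdir
  have hle : ∀ x, ‖φ x‖ ≤ C * r x := fun x => by
    refine (hs x).trans ?_
    have : (s.sup fun p : D => p.1.1) ≤ r.1 := Finset.sup_le hrs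
    exact mul_le_mul_of_nonneg_left (this x) C.2
  let φ' : Seminormed r →L[ℂ] ℂ :=
    LinearMap.mkContinuous (E := Seminormed r) (φ : E →ₗ[ℂ] ℂ) C hle
  refine ⟨r, hr, SeparationQuotient.liftCLM φ' ?_, fun x => ?_⟩
  · intro x y hxy
    exact (hxy.map φ'.continuous).eq
  · rfl

namespace HolomorphySystem

variable {Θ : HolomorphySystem E}

theorem HasPi1Family.isUniform_exp (h : Θ.HasPi1Family) (φ : E →L[ℂ] ℂ) :
    Θ.IsUniform fun x => Complex.exp (φ x) := by
  obtain ⟨D, hD, hp⟩ := h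
  obtain ⟨p, hpD, ψ, hψ⟩ := hD.exists_factor φ
  refine ⟨p, _, (hp p hpD).isBoundedType_exp ψ, ?_⟩
  ext x
  simp [hψ]

/-- The exponential `e^φ`, `φ ∈ E'`, as an element of `H_{uΘb}(E)`. -/
def HasPi1Family.expo (h : Θ.HasPi1Family) (φ : E →L[ℂ] ℂ) : Θ.Uniform :=
  ⟨fun x => Complex.exp (φ x), h.isUniform_exp φ⟩

/-- The Borel transform `(B T)(φ) = T (e^φ)`. -/
def HasPi1Family.borel (h : Θ.HasPi1Family) (T : Θ.Uniform →L[ℂ] ℂ) (φ : E →L[ℂ] ℂ) : ℂ := T (h.expo φ)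

/-- The span of the exponentials `e^φ`, `φ ∈ U`. -/
def HasPi1Family.expSpan (h : Θ.HasPi1Family) (U : Set (E →L[ℂ] ℂ)) : Submodule ℂ Θ.Uniform :=
  Submodule.span ℂ (h.expo '' U)

/-- The exponential `e^φ`, `φ ∈ U`, as an element of the span of these exponentials. -/
def HasPi1Family.expoIn (h : Θ.HasPi1Family) (U : Set (E →L[ℂ] ℂ)) (φ : U) : h.expSpan U :=
  ⟨h.expo φ.1, Submodule.subset_span ⟨φ.1, φ.2, rfl⟩⟩

end HolomorphySystem

end LocallyConvex

end UniformHolo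

end

/-! A convolution operator has every exponential as an eigenvector: `L (e^φ) = b(φ) e^φ` with `b`
the Borel transform of `Γ L` (`apply_expo`). So powers of `L` contract the exponentials with `|b| <
1`, and division by `b` gives a right inverse whose powers contract those with `|b| > 1`. What
remains is density, and the existence of that right inverse.

Density is a duality argument by Hahn–Banach. The Borel transform of any continuous functional is
entire along complex lines (`differentiable_borel`) and determines the functional
(`eq_zero_of_borel`). A functional that kills `e^φ` for all `φ` in a set open along lines therefore
has zero Borel transform, by the identity theorem on lines, and vanishes. The sets `V` and `W` are
nonempty by Liouville: if `b` were constant, `L` would agree with a scalar on all exponentials and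
so be trivial.

The two facts about the Borel transform are proved on a normed space with a `π₁`-type. There the
Taylor series converges in `H_{Θb}(X)`, so a functional is determined by its values on homogeneous
polynomials, hence, by density of finite type polynomials, on powers `φᵐ`; these values are the
Taylor coefficients of `z ↦ T (e^{zφ})`. The facts pass to `E` because the spaces `E_p`, `p ∈ D`,
are cofinal.

The right inverse is the inverse of `L` restricted to the span of the exponentials. Independence of
eigenspaces makes this restriction injective, so linear independence of the exponentials is never
needed. -/

namespace UniformHolo

/-! ### Homogeneous polynomials and Taylor series along complex lines. -/

section Normed

variable {X : Type*} [NormedAddCommGroup X] [NormedSpace ℂ X]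

/-- The chain rule for the linear map `z ↦ z • x` reduces Taylor coefficients at the origin to those
of a function of one complex variable. -/
theorem taylorTerm_zero_eq_iteratedDeriv (m : ℕ) {f : X → ℂ} (hf : AnalyticOnNhd ℂ f Set.univ)
    (x : X) :
    taylorTerm m f 0 x = ((m.factorial : ℂ))⁻¹ * iteratedDeriv m (fun z : ℂ => f (z • x)) 0 := by
  have h := (ContinuousLinearMap.toSpanSingleton ℂ x).iteratedFDeriv_comp_right
    (f := f) (n := m) hf.contDiff 0 (i := m) le_rfl
  have h2 : (fun z : ℂ => f (z • x)) = f ∘ ContinuousLinearMap.toSpanSingleton ℂ x := rfl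
  rw [taylorTerm, iteratedDeriv_eq_iteratedFDeriv, h2, h]
  simp

/-- An entire function is the pointwise sum of its Taylor series at the origin. -/
theorem hasSum_taylorTerm {f : X → ℂ} (hf : AnalyticOnNhd ℂ f Set.univ) (x : X) :
    HasSum (fun m => taylorTerm m f 0 x) (f x) := by
  have hd : Differentiable ℂ fun z : ℂ => f (z • x) := fun z =>
    (hf (z • x) trivial).differentiableAt.comp z (differentiableAt_id.smul_const x)
  -- The slice `z ↦ f (z • x)` is expanded at `0` and evaluated at `z = 1`.
  have h := Complex.hasSum_taylorSeries_of_entire hd 0 1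
  simpa [taylorTerm_zero_eq_iteratedDeriv _ hf] using h

theorem IsHomPoly.analyticOnNhd {m : ℕ} {P : X → ℂ} (hP : IsHomPoly m P) :
    AnalyticOnNhd ℂ P Set.univ := by
  obtain ⟨A, hA⟩ := hP
  have h : P = A ∘ ContinuousLinearMap.pi fun _ : Fin m => ContinuousLinearMap.id ℂ X := by
    ext x
    exact hA x
  rw [h]
  exact (A.contDiff.comp (ContinuousLinearMap.contDiff _)).analyticOnNhd

theorem IsHomPoly.map_smul {m : ℕ} {P : X → ℂ} (hP : IsHomPoly m P) (c : ℂ) (x : X) :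
    P (c • x) = c ^ m * P x := by
  obtain ⟨A, hA⟩ := hP
  rw [hA, hA, A.map_smul_univ (fun _ => c) fun _ => x]
  simp

/-- By homogeneity the slice through `x` is the monomial `z ^ m * P x`, whose only nonzero Taylor
coefficient at `0` has order `m`. -/
theorem IsHomPoly.taylorTerm_zero {m : ℕ} {P : X → ℂ} (hP : IsHomPoly m P) (k : ℕ) :
    taylorTerm k P 0 = if k = m then P else 0 := by
  ext x
  have h : (fun z : ℂ => P (z • x)) = fun z : ℂ => z ^ m * P x := by
    ext z
    exact hP.map_smul z x
  rw [taylorTerm_zero_eq_iteratedDeriv k hP.analyticOnNhd, h]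
  have h1 : iteratedDeriv k (fun z : ℂ => z ^ m * P x) 0
      = iteratedDeriv k (fun z : ℂ => z ^ m) 0 * P x := by
    simp only [iteratedDeriv_eq_iterate, mul_comm _ (P x)]
    rw [← iteratedDeriv_eq_iterate, ← iteratedDeriv_eq_iterate]
    exact iteratedDeriv_const_mul_field (P x) _
  rw [h1, iteratedDeriv_fun_pow_zero]
  by_cases hk : k = m
  · subst hk
    have : (k.factorial : ℂ) ≠ 0 := by exact_mod_cast k.factorial_ne_zero
    simp [this]
  · simp [hk]

/-- Along a complex line of functionals, the `m`-th power is a combination, with polynomial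
coefficients, of finitely many of its values. -/
theorem exists_pow_line_eq (m : ℕ) : ∃ ℓ : ℕ → Polynomial ℂ, ∀ a b z : ℂ,
    (a + z * b) ^ m = ∑ i ∈ Finset.range (m + 1), (ℓ i).eval z * (a + (i : ℂ) * b) ^ m := by
  -- As a polynomial in `z` the power has degree at most `m`, so Lagrange interpolation at the nodes
  -- `0, …, m` recovers it.
  refine ⟨fun i => Lagrange.basis (Finset.range (m + 1)) (fun j : ℕ => (j : ℂ)) i,
    fun a b z => ?_⟩
  let f : Polynomial ℂ := (Polynomial.C a + Polynomial.X * Polynomial.C b) ^ m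
  have hdeg : f.degree < (Finset.range (m + 1)).card := by
    rw [Finset.card_range]
    have h1 : (Polynomial.C a + Polynomial.X * Polynomial.C b).degree ≤ 1 := by
      refine (Polynomial.degree_add_le _ _).trans (max_le ?_ ?_)
      · exact Polynomial.degree_C_le.trans (by norm_num)
      · rw [mul_comm]
        exact Polynomial.degree_C_mul_X_le b
    have h2 : f.degree ≤ m := by
      refine (Polynomial.degree_pow_le_of_le m h1).trans ?_
      simp
    exact h2.trans_lt (by exact_mod_cast Nat.lt_succ_self m)
  have h := Lagrange.eq_interpolate (s := Finset.range (m + 1)) (v := fun j : ℕ => (j : ℂ))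
    (Nat.cast_injective.injOn) hdeg
  have h' := congrArg (Polynomial.eval z) h
  rw [Lagrange.interpolate_apply, Polynomial.eval_finsetSum] at h'
  have hf : ∀ w, f.eval w = (a + w * b) ^ m := fun w => by simp [f]; ring
  simp only [hf, Polynomial.eval_mul, Polynomial.eval_C] at h'
  rw [h']
  exact Finset.sum_congr rfl fun i _ => mul_comm _ _

end Normed

/-! ### Taylor series and continuous functionals on `H_{Θb}(X)`. -/

namespace HolomorphyType

variable {X : Type*} [NormedAddCommGroup X] [NormedSpace ℂ X] {Θ : HolomorphyType X}

/-- A `Θ`-polynomial, as a function of `Θ`-bounded type. -/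
noncomputable def ofPoly (Θ : HolomorphyType X) (m : ℕ) : Θ.carrier m →ₗ[ℂ] Θ.BoundedType where
  toFun P := ⟨P.1, by
    have ht := (Θ.isHomPoly m P.1 P.2).taylorTerm_zero
    refine isBoundedType_of_summable (Θ.isHomPoly m P.1 P.2).analyticOnNhd (fun k => ?_)
      fun ρ _ => summable_of_ne_finset_zero (s := {m}) fun k hk => ?_
    · rw [ht]
      split_ifs with h
      · exact h ▸ P.2
      · exact (Θ.carrier k).zero_mem
    · rw [ht, if_neg (by simpa using hk), Θ.nrm_zero, mul_zero]⟩
  map_add' _ _ := rfl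
  map_smul' _ _ := rfl

theorem coe_ofPoly {m : ℕ} (P : Θ.carrier m) : Θ.toFunₗ (Θ.ofPoly m P) = P.1 := rfl

/-- The `m`-th Taylor coefficient at the origin, as a linear map. -/
noncomputable def coeff (Θ : HolomorphyType X) (m : ℕ) : Θ.BoundedType →ₗ[ℂ] Θ.carrier m where
  toFun f := ⟨taylorTerm m f 0, (Θ.isBoundedType_coe f).mem m⟩
  map_add' f g := by
    ext1
    exact taylorTerm_add m (Θ.isBoundedType_coe f).analytic (Θ.isBoundedType_coe g).analytic 0
  map_smul' c f := by
    ext1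
    exact taylorTerm_smul m c (Θ.isBoundedType_coe f).analytic 0

theorem coe_coeff (m : ℕ) (f : Θ.BoundedType) : (Θ.coeff m f).1 = taylorTerm m f 0 := rfl

theorem coeff_ofPoly_self {m : ℕ} (P : Θ.carrier m) : Θ.coeff m (Θ.ofPoly m P) = P := by
  ext1
  rw [coe_coeff, coe_ofPoly, (Θ.isHomPoly m P.1 P.2).taylorTerm_zero, if_pos rfl]

theorem coeff_ofPoly_of_ne {k m : ℕ} (h : k ≠ m) (P : Θ.carrier m) :
    Θ.coeff k (Θ.ofPoly m P) = 0 := by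
  ext1
  rw [coe_coeff, coe_ofPoly, (Θ.isHomPoly m P.1 P.2).taylorTerm_zero, if_neg h]
  rfl

theorem rhoSeminorm_apply (ρ : {ρ : ℝ // 0 < ρ}) (f : Θ.BoundedType) :
    Θ.rhoSeminorm ρ f = ∑' m : ℕ, ρ.1 ^ m * Θ.nrm m (Θ.coeff m f).1 := rfl

theorem rhoSeminorm_ofPoly (ρ : {ρ : ℝ // 0 < ρ}) {m : ℕ} (P : Θ.carrier m) :
    Θ.rhoSeminorm ρ (Θ.ofPoly m P) = ρ.1 ^ m * Θ.nrm m P.1 := by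
  rw [rhoSeminorm_apply, tsum_eq_single m, coeff_ofPoly_self]
  intro k hk
  rw [coeff_ofPoly_of_ne hk]
  exact mul_eq_zero_of_right _ (Θ.nrm_zero k)

theorem rhoSeminorm_mono {ρ r : {ρ : ℝ // 0 < ρ}} (h : ρ.1 ≤ r.1) :
    Θ.rhoSeminorm ρ ≤ Θ.rhoSeminorm r := by
  intro f
  have hf := Θ.isBoundedType_coe f
  refine (hf.summable ρ.2).tsum_le_tsum (fun m => ?_) (hf.summable r.2)
  exact mul_le_mul_of_nonneg_right (pow_le_pow_left₀ ρ.2.le h m) (Θ.nrm_nonneg (hf.mem m))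

/-- The Taylor series of a function of `Θ`-bounded type converges to it in `H_{Θb}(X)`. -/
theorem hasSum_ofPoly_coeff (f : Θ.BoundedType) :
    HasSum (fun m => Θ.ofPoly m (Θ.coeff m f)) f := by
  have hf := Θ.isBoundedType_coe f
  refine (Θ.withSeminorms.tendsto_nhds _ f).2 fun ρ ε hε => ?_
  have ha := hf.summable ρ.2
  -- The error of a partial sum has zero coefficients on `s` and, up to sign, those of `f` off `s`;
  -- its seminorm is exactly the tail of a convergent numerical series.
  have hs : ∀ s : Finset ℕ,
      Θ.rhoSeminorm ρ ((∑ m ∈ s, Θ.ofPoly m (Θ.coeff m f)) - f)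
        = (∑' m, ρ.1 ^ m * Θ.nrm m (taylorTerm m f 0))
          - ∑ m ∈ s, ρ.1 ^ m * Θ.nrm m (taylorTerm m f 0) := by
    intro s
    rw [← map_neg_eq_map, neg_sub, rhoSeminorm_apply,
      sum_eq_tsum_indicator (fun m => ρ.1 ^ m * Θ.nrm m (taylorTerm m f 0)) s,
      ← ha.tsum_sub (summable_of_ne_finset_zero (s := s) fun m hm => by
        exact Set.indicator_of_notMem (by exact_mod_cast hm) _)]
    refine tsum_congr fun m => ?_
    rw [map_sub, map_sum]
    by_cases hm : m ∈ s
    · rw [Finset.sum_eq_single_of_mem m hm fun k _ hk => coeff_ofPoly_of_ne hk.symm _,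
        coeff_ofPoly_self, sub_self, Set.indicator_of_mem (by exact_mod_cast hm), sub_self]
      exact mul_eq_zero_of_right _ (Θ.nrm_zero m)
    · rw [Finset.sum_eq_zero fun k hk => coeff_ofPoly_of_ne (by rintro rfl; exact hm hk) _,
        sub_zero, Set.indicator_of_notMem (by exact_mod_cast hm), sub_zero, coe_coeff]
  have ht := ha.hasSum
  have h1 : Tendsto (fun s : Finset ℕ => (∑' m, ρ.1 ^ m * Θ.nrm m (taylorTerm m f 0))
      - ∑ m ∈ s, ρ.1 ^ m * Θ.nrm m (taylorTerm m f 0)) atTop (𝓝 0) := by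
    simpa using (tendsto_const_nhds (x := ∑' m, ρ.1 ^ m * Θ.nrm m (taylorTerm m f 0))).sub ht
  simp only [SummationFilter.unconditional_filter]
  simp only [hs]
  exact h1.eventually (gt_mem_nhds hε)

/-- Evaluation at a point is continuous on `H_{Θb}(X)`. -/
theorem continuous_eval (Θ : HolomorphyType X) (x : X) :
    Continuous fun f : Θ.BoundedType => f x := by
  have hT := Θ.withSeminorms.topologicalAddGroup
  obtain ⟨σ, hσ, hd⟩ := Θ.derivative_bound
  let e : Θ.BoundedType →ₗ[ℂ] ℂ := (LinearMap.proj x).comp Θ.toFunₗ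
  change Continuous e
  -- The derivative bound with `k = 0` gives `|P x| ≤ σ ^ m * ‖P‖_Θ * ‖x‖ ^ m`, which suggests the
  -- radius `σ * ‖x‖`; the `+ 1` keeps it positive at `x = 0`.
  have hρ : 0 < σ * (‖x‖ + 1) := by positivity
  refine WithSeminorms.continuous_of_isBounded Θ.withSeminorms (norm_withSeminorms ℂ ℂ) e
    fun _ => ⟨{⟨_, hρ⟩}, 1, fun f => ?_⟩
  have hf := Θ.isBoundedType_coe f
  have hb : ∀ m, ‖taylorTerm m f 0 x‖
      ≤ (σ * (‖x‖ + 1)) ^ m * Θ.nrm m (taylorTerm m f 0) := by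
    intro m
    obtain ⟨h1, h2⟩ := hd 0 m (Nat.zero_le m) x _ (hf.mem m)
    rw [Θ.nrm_zero_eq _ h1, taylorTerm_order_zero, Nat.sub_zero] at h2
    refine h2.trans ?_
    rw [mul_pow, mul_right_comm]
    have := Θ.nrm_nonneg (hf.mem m)
    gcongr
    linarith
  have h3 : ‖f x‖ ≤ ∑' m, (σ * (‖x‖ + 1)) ^ m * Θ.nrm m (taylorTerm m f 0) := by
    rw [← (hasSum_taylorTerm hf.analytic x).tsum_eq]
    exact tsum_of_norm_bounded (hf.summable hρ).hasSum hb
  simpa [e, rhoSeminorm_apply, coe_coeff] using h3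

/-- A continuous functional on `H_{Θb}(X)` is bounded by one of the seminorms `‖·‖_{Θ,ρ}`. -/
theorem exists_bound (T : Θ.BoundedType →L[ℂ] ℂ) :
    ∃ (ρ : {ρ : ℝ // 0 < ρ}) (C : ℝ), 0 ≤ C ∧ ∀ f, ‖T f‖ ≤ C * Θ.rhoSeminorm ρ f := by
  have hT := Θ.withSeminorms.topologicalAddGroup
  obtain ⟨s, C, _, hs⟩ := Seminorm.bound_of_continuous Θ.withSeminorms
    ((normSeminorm ℂ ℂ).comp (T : Θ.BoundedType →ₗ[ℂ] ℂ)) T.continuous.norm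
  -- The seminorms increase with `ρ`, so a finite supremum of them is dominated by a single one.
  have hR : ∃ r : {ρ : ℝ // 0 < ρ}, ∀ ρ ∈ s, ρ.1 ≤ r.1 := by
    have : Nonempty {ρ : ℝ // 0 < ρ} := ⟨⟨1, one_pos⟩⟩
    obtain ⟨r, hr⟩ := s.exists_le
    exact ⟨r, fun ρ hρ => hr ρ hρ⟩
  obtain ⟨r, hr⟩ := hR
  refine ⟨r, C, C.2, fun f => (hs f).trans ?_⟩
  have : s.sup Θ.rhoSeminorm ≤ Θ.rhoSeminorm r :=
    Finset.sup_le fun ρ hρ => rhoSeminorm_mono (hr ρ hρ)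
  exact mul_le_mul_of_nonneg_left (this f) C.2

/-! ### Exponentials and the Borel transform on a normed space. -/

namespace IsPi1

variable (h : Θ.IsPi1)
include h

theorem pow_mem (φ : X →L[ℂ] ℂ) (m : ℕ) : (fun x => φ x ^ m) ∈ Θ.carrier m :=
  h.finiteType_le m (Submodule.subset_span ⟨φ, rfl⟩)

theorem exists_nrm_pow_le : ∃ K : ℝ, 0 < K ∧ ∀ (m : ℕ) (φ : X →L[ℂ] ℂ),
    Θ.nrm m (fun x => φ x ^ m) ≤ (K * ‖φ‖) ^ m := by
  obtain ⟨K, hK, hb⟩ := h.bound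
  refine ⟨K, hK, fun m φ => ?_⟩
  -- The `π₁` bound starts at `m = 1`; for `m = 0` the constant `1` has norm `1` by normalization.
  rcases Nat.eq_zero_or_pos m with rfl | hm
  · rw [Θ.nrm_zero_eq _ (h.pow_mem φ 0)]
    simp
  · simpa [mul_pow] using hb m hm φ 1

end IsPi1

/-- The power `φᵐ` of a functional, in `H_{Θb}(X)`. -/
noncomputable def IsPi1.powB (h : Θ.IsPi1) (φ : X →L[ℂ] ℂ) (m : ℕ) : Θ.BoundedType :=
  Θ.ofPoly m ⟨_, h.pow_mem φ m⟩

/-- The exponential of a functional, in `H_{Θb}(X)`. -/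
noncomputable def IsPi1.expB (h : Θ.IsPi1) (φ : X →L[ℂ] ℂ) : Θ.BoundedType :=
  ⟨_, h.isBoundedType_exp φ⟩

/-- The exponential series is the Taylor series of `e^φ`, so it converges in `H_{Θb}(X)` and `T` may
be applied term by term. -/
theorem IsPi1.hasSum_apply_expB (h : Θ.IsPi1) (T : Θ.BoundedType →L[ℂ] ℂ) (φ : X →L[ℂ] ℂ) :
    HasSum (fun m => ((m.factorial : ℂ))⁻¹ * T (h.powB φ m)) (T (h.expB φ)) := by
  have h1 := (hasSum_ofPoly_coeff (h.expB φ)).mapL T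
  have h2 : ∀ m, Θ.ofPoly m (Θ.coeff m (h.expB φ)) = ((m.factorial : ℂ))⁻¹ • h.powB φ m := by
    intro m
    rw [IsPi1.powB, ← map_smul]
    congr 1
    ext1
    exact taylorTerm_exp m φ
  simpa only [h2, map_smul, smul_eq_mul] using h1

/-- Geometric growth in `m`, against the factor `1 / m!`, yields locally uniform convergence of the
series for the Borel transform. -/
theorem IsPi1.exists_norm_apply_powB_le (h : Θ.IsPi1) (T : Θ.BoundedType →L[ℂ] ℂ) :
    ∃ C R : ℝ, 0 ≤ C ∧ 0 < R ∧ ∀ (φ : X →L[ℂ] ℂ) (m : ℕ),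
      ‖T (h.powB φ m)‖ ≤ C * (R * ‖φ‖) ^ m := by
  obtain ⟨ρ, C, hC, hT⟩ := exists_bound T
  obtain ⟨K, hK, hb⟩ := h.exists_nrm_pow_le
  refine ⟨C, ρ.1 * K, hC, mul_pos ρ.2 hK, fun φ m => (hT _).trans ?_⟩
  rw [IsPi1.powB, rhoSeminorm_ofPoly, mul_assoc ρ.1, mul_pow ρ.1]
  have := ρ.2
  gcongr
  exact hb m φ

/-- The Borel transform is entire along complex lines. -/
theorem IsPi1.differentiable_apply_expB (h : Θ.IsPi1) (T : Θ.BoundedType →L[ℂ] ℂ)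
    (φ ψ : X →L[ℂ] ℂ) : Differentiable ℂ fun z : ℂ => T (h.expB (φ + z • ψ)) := by
  obtain ⟨C, R, hC, hR, hb⟩ := h.exists_norm_apply_powB_le T
  have hterm : ∀ m : ℕ, Differentiable ℂ fun z : ℂ =>
      ((m.factorial : ℂ))⁻¹ * T (h.powB (φ + z • ψ) m) := by
    intro m
    obtain ⟨ℓ, hℓ⟩ := exists_pow_line_eq m
    -- Interpolation moves `z` into scalar coefficients in front of finitely many fixed powers, so
    -- applying `T` gives a polynomial in `z`.
    have he : ∀ z : ℂ, T (h.powB (φ + z • ψ) m) = ∑ i ∈ Finset.range (m + 1),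
        (ℓ i).eval z * T (h.powB (φ + (i : ℂ) • ψ) m) := by
      intro z
      have : h.powB (φ + z • ψ) m = ∑ i ∈ Finset.range (m + 1),
          (ℓ i).eval z • h.powB (φ + (i : ℂ) • ψ) m := by
        simp only [IsPi1.powB, ← map_smul, ← map_sum]
        congr 1
        ext x
        rw [Submodule.coe_sum, Finset.sum_apply]
        exact hℓ (φ x) (ψ x) z
      rw [this, map_sum]
      simp only [map_smul, smul_eq_mul]
    have hd : Differentiable ℂ fun z : ℂ => ((m.factorial : ℂ))⁻¹ * ∑ i ∈ Finset.range (m + 1),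
        (ℓ i).eval z * T (h.powB (φ + (i : ℂ) • ψ) m) := by fun_prop
    exact (funext fun z => congrArg (fun w => ((m.factorial : ℂ))⁻¹ * w) (he z)) ▸ hd
  intro z₀
  -- Weierstrass' theorem on a disc containing `z₀`, where `‖φ + z • ψ‖` is bounded and an
  -- exponential series is a majorant.
  have hd : DifferentiableOn ℂ (fun z : ℂ => ∑' m : ℕ,
      ((m.factorial : ℂ))⁻¹ * T (h.powB (φ + z • ψ) m)) (Metric.ball 0 (‖z₀‖ + 1)) := by
    refine Complex.differentiableOn_tsum_of_summable_norm
      (u := fun m : ℕ => C * ((R * (‖φ‖ + (‖z₀‖ + 1) * ‖ψ‖)) ^ m / m.factorial))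
      ((Real.summable_pow_div_factorial _).mul_left C) (fun m => (hterm m).differentiableOn)
      Metric.isOpen_ball fun m z hz => ?_
    rw [mem_ball_zero_iff] at hz
    have h1 : ‖φ + z • ψ‖ ≤ ‖φ‖ + (‖z₀‖ + 1) * ‖ψ‖ := by
      refine (norm_add_le _ _).trans ?_
      rw [norm_smul]
      gcongr
    rw [norm_mul, norm_inv, Complex.norm_natCast, mul_comm, ← div_eq_mul_inv, ← mul_div_assoc]
    have h2 := hb (φ + z • ψ) m
    refine div_le_div_of_nonneg_right (h2.trans ?_) (by positivity)
    gcongr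
  have he : (fun z : ℂ => T (h.expB (φ + z • ψ)))
      = fun z : ℂ => ∑' m : ℕ, ((m.factorial : ℂ))⁻¹ * T (h.powB (φ + z • ψ) m) := by
    ext z
    exact (h.hasSum_apply_expB T _).tsum_eq.symm
  rw [he]
  exact hd.differentiableAt (Metric.isOpen_ball.mem_nhds (by simp))

/-- The exponentials are total in `H_{Θb}(X)`. -/
theorem IsPi1.eq_zero_of_apply_expB (h : Θ.IsPi1) (T : Θ.BoundedType →L[ℂ] ℂ)
    (hT : ∀ φ, T (h.expB φ) = 0) : T = 0 := by
  have hpow : ∀ (φ : X →L[ℂ] ℂ) (m : ℕ), T (h.powB φ m) = 0 := by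
    intro φ
    -- Applied to `z • φ`, the hypothesis says that a power series in `z` with coefficients `T (φᵐ)
    -- / m!` vanishes identically.
    have hs : ∀ z : ℂ, HasSum (fun m : ℕ => z ^ m • (((m.factorial : ℂ))⁻¹ * T (h.powB φ m)))
        (0 : ℂ) := by
      intro z
      have h1 := h.hasSum_apply_expB T (z • φ)
      rw [hT] at h1
      have h2 : ∀ m, h.powB (z • φ) m = z ^ m • h.powB φ m := by
        intro m
        rw [IsPi1.powB, IsPi1.powB, ← map_smul]
        congr 1
        ext x
        simp [mul_pow]
      simpa only [h2, map_smul, smul_eq_mul, mul_left_comm] using h1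
    have hp : HasFPowerSeriesAt (fun _ : ℂ => (0 : ℂ)) (FormalMultilinearSeries.ofScalars ℂ
        fun m : ℕ => ((m.factorial : ℂ))⁻¹ * T (h.powB φ m)) 0 := by
      rw [hasFPowerSeriesAt_iff]
      refine Filter.Eventually.of_forall fun z => ?_
      simpa [FormalMultilinearSeries.coeff_ofScalars] using hs z
    intro m
    have h0 := congrArg (fun p => FormalMultilinearSeries.coeff p m) (hp.eq_zero)
    have hm : (m.factorial : ℂ) ≠ 0 := by exact_mod_cast m.factorial_ne_zero
    rw [FormalMultilinearSeries.coeff_ofScalars] at h0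
    exact (mul_eq_zero.1 h0).resolve_left (inv_ne_zero hm)
  have hfin : ∀ (m : ℕ) (Q : X → ℂ) (hQ : Q ∈ finiteTypePoly X m),
      T (Θ.ofPoly m ⟨Q, h.finiteType_le m hQ⟩) = 0 := by
    intro m Q hQ
    -- The kernel of `T` on `Θ.carrier m` is mapped into the space of all functions, where it can be
    -- compared with the span of the powers.
    have hle : finiteTypePoly X m ≤ (LinearMap.ker
        ((T : Θ.BoundedType →ₗ[ℂ] ℂ).comp (Θ.ofPoly m))).map (Θ.carrier m).subtype := by
      refine Submodule.span_le.2 ?_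
      rintro _ ⟨φ, rfl⟩
      exact ⟨⟨_, h.pow_mem φ m⟩, hpow φ m, rfl⟩
    obtain ⟨P, hP, hPQ⟩ := hle hQ
    have : (⟨Q, h.finiteType_le m hQ⟩ : Θ.carrier m) = P := Subtype.ext hPQ.symm
    rw [this]
    exact hP
  obtain ⟨ρ, C, hC, hb⟩ := exists_bound T
  have hpoly : ∀ (m : ℕ) (P : Θ.carrier m), T (Θ.ofPoly m P) = 0 := by
    intro m P
    by_contra hne
    have hpos : 0 < ‖T (Θ.ofPoly m P)‖ := norm_pos_iff.2 hne
    have hρ := ρ.2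
    -- The tolerance is chosen so that `|T P| = |T (P - Q)| ≤ C ρ ^ m ‖P - Q‖_Θ < |T P|`; `C + 1`
    -- avoids division by zero.
    obtain ⟨Q, hQ, hPQ⟩ := h.dense m P.1 P.2
      (‖T (Θ.ofPoly m P)‖ / ((C + 1) * ρ.1 ^ m)) (by positivity)
    rw [lt_div_iff₀ (by positivity)] at hPQ
    have h1 := hb (Θ.ofPoly m (P - ⟨Q, h.finiteType_le m hQ⟩))
    rw [rhoSeminorm_ofPoly, map_sub, map_sub, hfin m Q hQ, sub_zero] at h1
    change _ ≤ C * (ρ.1 ^ m * Θ.nrm m (P.1 - Q)) at h1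
    have h2 : 0 ≤ ρ.1 ^ m * Θ.nrm m (P.1 - Q) := mul_nonneg (by positivity)
      (Θ.nrm_nonneg ((Θ.carrier m).sub_mem P.2 (h.finiteType_le m hQ)))
    nlinarith
  ext f
  have hf := (hasSum_ofPoly_coeff f).mapL T
  simp only [hpoly] at hf
  exact hf.unique hasSum_zero

end HolomorphyType

end UniformHolo

/-! ### Consequences of Liouville and Hahn–Banach. -/

namespace UniformHolo

/-- A nonconstant entire function takes values inside and outside the closed unit disc. -/
theorem exists_norm_lt_one_and_one_lt_norm {g : ℂ → ℂ} (hg : Differentiable ℂ g) {a b : ℂ}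
    (hab : g a ≠ g b) : (∃ z, ‖g z‖ < 1) ∧ ∃ z, 1 < ‖g z‖ := by
  constructor
  · by_contra! hz
    have hne : ∀ z, g z ≠ 0 := fun z => norm_pos_iff.1 (one_pos.trans_le (hz z))
    -- If `|g| ≥ 1` everywhere, then `1 / g` is entire and bounded, hence constant.
    have hi : Differentiable ℂ fun z => (g z)⁻¹ := hg.inv hne
    have hb : Bornology.IsBounded (Set.range fun z => (g z)⁻¹) := by
      refine isBounded_iff_forall_norm_le.2 ⟨1, ?_⟩
      rintro _ ⟨z, rfl⟩
      simpa using inv_le_one_of_one_le₀ (hz z)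
    exact hab (inv_injective (hi.apply_eq_apply_of_bounded hb a b))
  · by_contra! hz
    have hb : Bornology.IsBounded (Set.range g) := by
      refine isBounded_iff_forall_norm_le.2 ⟨1, ?_⟩
      rintro _ ⟨z, rfl⟩
      exact hz z
    exact hab (hg.apply_eq_apply_of_bounded hb a b)

/-- A subspace that is annihilated only by the zero functional is dense. -/
theorem dense_of_forall_functional {F : Type*} [AddCommGroup F] [Module ℂ F] [TopologicalSpace F]
    [IsTopologicalAddGroup F] [ContinuousSMul ℂ F] [LocallyConvexSpace ℝ F] (H : Submodule ℂ F)
    (h : ∀ T : F →L[ℂ] ℂ, (∀ x ∈ H, T x = 0) → T = 0) : Dense (H : Set F) := by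
  intro x
  by_contra hx
  have : ContinuousSMul ℝ F := IsScalarTower.continuousSMul ℂ
  obtain ⟨T, u, hu, hux⟩ := RCLike.geometric_hahn_banach_closed_point (𝕜 := ℂ)
    ((H.restrictScalars ℝ).convex.closure) isClosed_closure hx
  have hT : ∀ y ∈ H, T y = 0 := by
    intro y hy
    by_contra hne
    -- If `T y ≠ 0`, this multiple of `y` lies in `H` and `T` takes exactly the value `u` on it,
    -- against the strict separation.
    have h1 := hu _ (subset_closure (H.smul_mem ((u : ℂ) / T y) hy))
    rw [map_smul, smul_eq_mul, div_mul_cancel₀ _ hne] at h1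
    simp at h1
  have h0 := hu 0 (subset_closure H.zero_mem)
  rw [h T hT] at h0 hux
  simp at h0 hux
  exact lt_asymm h0 hux

/-! ### From the normed spaces `E_p` to `E`. -/

section LocallyConvex

variable {E : Type*} [AddCommGroup E] [Module ℂ E] [TopologicalSpace E]

/-- Every continuous seminorm is dominated by a multiple of one in a given fundamental family. -/
theorem IsFundamentalFamily.exists_bound {D : Set (ContSeminorm E)} (hD : IsFundamentalFamily D)
    (p : ContSeminorm E) : ∃ r ∈ D, ∃ C : ℝ, ∀ x, p x ≤ C * r x := by
  classical
  have := hD.generates.topologicalAddGroup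
  obtain ⟨s, C, _, hs⟩ := Seminorm.bound_of_continuous hD.generates p.1 p.2
  have hdir : ∀ s : Finset D, ∃ r ∈ D, ∀ p ∈ s, (p : ContSeminorm E).1 ≤ r.1 := by
    intro s
    induction s using Finset.induction_on with
    | empty =>
      obtain ⟨r, hr⟩ := hD.nonempty
      exact ⟨r, hr, by simp⟩
    | insert a t _ ih =>
      obtain ⟨r, hr, h⟩ := ih
      obtain ⟨r', hr', h1, h2⟩ := hD.directed a.1 a.2 r hr
      refine ⟨r', hr', fun p hp => ?_⟩
      rcases Finset.mem_insert.1 hp with rfl | hp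
      · exact h1
      · exact (h p hp).trans h2
  obtain ⟨r, hr, hrs⟩ := hdir s
  refine ⟨r, hr, C, fun x => (hs x).trans ?_⟩
  have : (s.sup fun p : D => p.1.1) ≤ r.1 := Finset.sup_le hrs
  exact mul_le_mul_of_nonneg_left (this x) C.2

/-- The bound makes `φ` continuous for the seminorm `r`, so it is constant on inseparable points and
descends to the quotient. -/
theorem exists_factor_of_bound (r : ContSeminorm E) (φ : E →L[ℂ] ℂ) {C : ℝ}
    (hφ : ∀ x, ‖φ x‖ ≤ C * r x) : ∃ ψ : LocalSpace r →L[ℂ] ℂ, ∀ x, ψ (proj r x) = φ x := by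
  let φ' : Seminormed r →L[ℂ] ℂ :=
    LinearMap.mkContinuous (E := Seminormed r) (φ : E →ₗ[ℂ] ℂ) C hφ
  exact ⟨SeparationQuotient.liftCLM φ' fun x y hxy => (hxy.map φ'.continuous).eq, fun x => rfl⟩

/-- Two continuous functionals factor through a common `E_r`, with `r` in a given fundamental
family. -/
theorem IsFundamentalFamily.exists_factor_pair {D : Set (ContSeminorm E)}
    (hD : IsFundamentalFamily D) (φ ψ : E →L[ℂ] ℂ) :
    ∃ r ∈ D, ∃ φ' ψ' : LocalSpace r →L[ℂ] ℂ,
      (∀ x, φ' (proj r x) = φ x) ∧ ∀ x, ψ' (proj r x) = ψ x := by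
  -- The sum `|φ| + |ψ|` dominates both functionals, so a single `r` serves for the two.
  let p : ContSeminorm E := ⟨(normSeminorm ℂ ℂ).comp (φ : E →ₗ[ℂ] ℂ)
    + (normSeminorm ℂ ℂ).comp (ψ : E →ₗ[ℂ] ℂ), φ.continuous.norm.add ψ.continuous.norm⟩
  have hp : ∀ x, p x = ‖φ x‖ + ‖ψ x‖ := fun x => rfl
  obtain ⟨r, hr, C, hC⟩ := hD.exists_bound p
  simp only [hp] at hC
  obtain ⟨φ', hφ'⟩ := exists_factor_of_bound r φ (C := C)
    fun x => (le_add_of_nonneg_right (norm_nonneg _)).trans (hC x)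
  obtain ⟨ψ', hψ'⟩ := exists_factor_of_bound r ψ (C := C)
    fun x => (le_add_of_nonneg_left (norm_nonneg _)).trans (hC x)
  exact ⟨r, hr, φ', ψ', hφ', hψ'⟩

namespace HolomorphySystem

variable {Θ : HolomorphySystem E}

theorem Uniform.ext {f g : Θ.Uniform} (h : ∀ x, f x = g x) : f = g :=
  Subtype.ext (funext h)

/-- Evaluation at a point, a continuous linear form on `H_{uΘb}(E)`. -/
noncomputable def evalAt (Θ : HolomorphySystem E) (a : E) : Θ.Uniform →L[ℂ] ℂ where
  toLinearMap := (LinearMap.proj a).comp Θ.toFunₗ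
  cont := by
    let e : Θ.Uniform →ₗ[ℂ] ℂ := (LinearMap.proj a).comp Θ.toFunₗ
    change Continuous e
    rw [continuous_iff_le_induced]
    refine sInf_le ⟨topologicalAddGroup_induced e, continuousSMul_induced e,
      LocallyConvexSpace.induced (e.restrictScalars ℝ), fun p => ?_⟩
    rw [continuous_induced_rng]
    exact (Θ.type p).continuous_eval (proj p a)

/-- The restriction to `H_{Θb}(E_p)` of a functional on `H_{uΘb}(E)`. -/
noncomputable def restrict (T : Θ.Uniform →L[ℂ] ℂ) (p : ContSeminorm E) :
    (Θ.type p).BoundedType →L[ℂ] ℂ :=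
  T.comp ⟨Θ.pullback p, Θ.continuous_pullback p⟩

theorem restrict_apply (T : Θ.Uniform →L[ℂ] ℂ) (p : ContSeminorm E)
    (f : (Θ.type p).BoundedType) : restrict T p f = T (Θ.pullback p f) := rfl

/-! ### The Borel transform on `H_{uΘb}(E)` and density of exponentials. -/

namespace HasPi1Family

variable (h : Θ.HasPi1Family)

theorem expo_apply (φ : E →L[ℂ] ℂ) (x : E) : h.expo φ x = Complex.exp (φ x) := rfl

theorem pullback_expB {p : ContSeminorm E} (hp : (Θ.type p).IsPi1) (ψ : LocalSpace p →L[ℂ] ℂ)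
    (φ : E →L[ℂ] ℂ) (hφ : ∀ x, ψ (proj p x) = φ x) :
    Θ.pullback p (hp.expB ψ) = h.expo φ :=
  Uniform.ext fun x => congrArg Complex.exp (hφ x)

/-- The whole line `φ + z • ψ` factors through one `E_r` with `r ∈ D`, where the normed case
applies. -/
theorem differentiable_borel (T : Θ.Uniform →L[ℂ] ℂ) (φ ψ : E →L[ℂ] ℂ) :
    Differentiable ℂ fun z : ℂ => h.borel T (φ + z • ψ) := by
  obtain ⟨D, hD, hp⟩ := id h
  obtain ⟨r, hr, φ', ψ', hφ, hψ⟩ := hD.exists_factor_pair φ ψ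
  have hd := (hp r hr).differentiable_apply_expB (restrict T r) φ' ψ'
  have he : ∀ z : ℂ, Θ.pullback r ((hp r hr).expB (φ' + z • ψ')) = h.expo (φ + z • ψ) :=
    fun z => h.pullback_expB (hp r hr) _ _ fun x => by
      change φ' (proj r x) + z * ψ' (proj r x) = φ x + z * ψ x
      rw [hφ, hψ]
  simp only [restrict_apply, he] at hd
  exact hd

/-- The Borel transform is injective. -/
theorem eq_zero_of_borel (T : Θ.Uniform →L[ℂ] ℂ) (hT : ∀ φ, h.borel T φ = 0) : T = 0 := by
  obtain ⟨D, hD, hp⟩ := id h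
  have hD0 : ∀ r ∈ D, restrict T r = 0 := by
    intro r hr
    refine (hp r hr).eq_zero_of_apply_expB _ fun ψ => ?_
    -- Since `|ψ ∘ π_r| ≤ ‖ψ‖ r`, every functional on `E_r` pulls back to an element of `E'`, so
    -- `restrict T r` kills every exponential on `E_r`.
    have hc : Continuous fun x : E => ψ (proj r x) := by
      have := hD.generates.topologicalAddGroup
      refine WithSeminorms.continuous_of_isBounded hD.generates (norm_withSeminorms ℂ ℂ)
        ((ψ : LocalSpace r →ₗ[ℂ] ℂ).comp (proj r)) fun _ => ⟨{⟨r, hr⟩}, ‖ψ‖₊, fun x => ?_⟩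
      have h1 := ψ.le_opNorm (proj r x)
      rw [norm_proj] at h1
      simpa [NNReal.smul_def] using h1
    let φ : E →L[ℂ] ℂ := ⟨(ψ : LocalSpace r →ₗ[ℂ] ℂ).comp (proj r), hc⟩
    rw [restrict_apply, h.pullback_expB (hp r hr) ψ φ fun x => rfl]
    exact hT φ
  refine ContinuousLinearMap.ext fun f => ?_
  -- The family `D` is cofinal up to constants, so the inductive system lets every `f` factor
  -- through some `E_r` with `r ∈ D`.
  obtain ⟨p, g, hg, hf⟩ := f.2
  obtain ⟨r, hr, C, hC⟩ := hD.exists_bound p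
  obtain ⟨g', hg', he⟩ := Θ.mono p r ⟨C, hC⟩ g hg
  have : Θ.pullback r ⟨g', hg'⟩ = f := Uniform.ext fun x => (he x).trans (congrFun hf x).symm
  rw [← this]
  exact congrArg (fun T' : (Θ.type r).BoundedType →L[ℂ] ℂ => T' ⟨g', hg'⟩) (hD0 r hr)

/-- The exponentials `e^φ`, `φ ∈ U`, are total if `U` is nonempty and open along complex lines. -/
theorem dense_expSpan {U : Set (E →L[ℂ] ℂ)} (hne : U.Nonempty)
    (hU : ∀ φ ∈ U, ∀ ψ, ∀ᶠ z : ℂ in 𝓝 0, φ + z • ψ ∈ U) :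
    Dense (h.expSpan U : Set Θ.Uniform) := by
  refine dense_of_forall_functional _ fun T hT => h.eq_zero_of_borel T fun χ => ?_
  obtain ⟨φ, hφ⟩ := hne
  -- On the line from `φ ∈ U` (at `z = 0`) to `χ` (at `z = 1`) the transform is entire and vanishes
  -- near `0`.
  have hd := h.differentiable_borel T φ (χ - φ)
  have hev : (fun z : ℂ => h.borel T (φ + z • (χ - φ))) =ᶠ[𝓝 0] fun _ => 0 :=
    (hU φ hφ (χ - φ)).mono fun z hz => hT _ (Submodule.subset_span ⟨_, hz, rfl⟩)
  have ha : AnalyticOnNhd ℂ (fun z : ℂ => h.borel T (φ + z • (χ - φ))) Set.univ :=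
    fun z _ => hd.analyticAt z
  have h1 := congrFun (ha.eq_of_eventuallyEq (fun z _ => analyticAt_const) hev) 1
  simpa using h1

/-- This is the openness along lines required by `dense_expSpan`; it needs no topology on `E'`. -/
theorem eventually_borel_mem (T : Θ.Uniform →L[ℂ] ℂ) {S : Set ℂ} (hS : IsOpen S)
    (φ : E →L[ℂ] ℂ) (hφ : h.borel T φ ∈ S) (ψ : E →L[ℂ] ℂ) :
    ∀ᶠ z : ℂ in 𝓝 0, h.borel T (φ + z • ψ) ∈ S := by
  have hc := (h.differentiable_borel T φ ψ).continuous.continuousAt (x := 0)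
  exact hc.eventually_mem (hS.mem_nhds (by rwa [zero_smul ℂ ψ, add_zero]))

/-! ### Convolution operators acting on exponentials. -/

/-- Exponentials are eigenvectors of convolution operators. -/
theorem apply_expo {L : Θ.Uniform →L[ℂ] Θ.Uniform} (hL : Θ.IsConvolution L) (φ : E →L[ℂ] ℂ) :
    L (h.expo φ) = h.borel (Θ.Gam L) φ • h.expo φ := by
  refine Uniform.ext fun x => ?_
  -- The translate `τ_x e^φ` equals `e^{-φ(x)} e^φ`; evaluating `L τ_x = τ_x L` at the point `x`
  -- itself brings in the value of `L (e^φ)` at `0`.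
  have h1 := hL x (h.expo φ) (Complex.exp (-φ x) • h.expo φ) (fun y => by
    rw [expo_apply, map_smul, Pi.smul_apply, expo_apply, smul_eq_mul, ← Complex.exp_add, map_sub]
    ring_nf) x
  have h2 : Θ.toFunₗ (L (h.expo φ)) 0 = h.borel (Θ.Gam L) φ := rfl
  rw [sub_self, h2, map_smul, map_smul, Pi.smul_apply, smul_eq_mul] at h1
  rw [map_smul, Pi.smul_apply, expo_apply, smul_eq_mul, ← h1, mul_right_comm, ← Complex.exp_add]
  simp

/-- The Borel transform of a nontrivial convolution operator is not constant. -/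
theorem exists_borel_ne {L : Θ.Uniform →L[ℂ] Θ.Uniform} (hL : Θ.IsConvolution L)
    (hnt : ¬ ∃ c : ℂ, L = c • ContinuousLinearMap.id ℂ Θ.Uniform) :
    ∃ φ, h.borel (Θ.Gam L) φ ≠ h.borel (Θ.Gam L) 0 := by
  by_contra! hc
  refine hnt ⟨h.borel (Θ.Gam L) 0, ContinuousLinearMap.ext fun f => Uniform.ext fun x => ?_⟩
  let c := h.borel (Θ.Gam L) 0
  -- If the eigenvalue is always `c`, the functional `f ↦ (L f)(x) - c f(x)` kills all exponentials,
  -- hence is zero.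
  have h0 : (Θ.evalAt x).comp L - c • Θ.evalAt x = 0 := by
    refine h.eq_zero_of_borel _ fun φ => ?_
    change Θ.evalAt x (L (h.expo φ)) - c • Θ.evalAt x (h.expo φ) = 0
    rw [h.apply_expo hL, hc φ, map_smul, sub_self]
  have h1 := congrArg (fun T : Θ.Uniform →L[ℂ] ℂ => T f) h0
  change Θ.toFunₗ (L f) x - c • Θ.toFunₗ f x = 0 at h1
  exact sub_eq_zero.1 h1

/-- Liouville is applied on the complex line through `0` and a functional where the transform
differs from its value at `0`. -/
theorem exists_borel_lt_and_gt {L : Θ.Uniform →L[ℂ] Θ.Uniform} (hL : Θ.IsConvolution L)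
    (hnt : ¬ ∃ c : ℂ, L = c • ContinuousLinearMap.id ℂ Θ.Uniform) :
    (∃ φ, ‖h.borel (Θ.Gam L) φ‖ < 1) ∧ ∃ φ, 1 < ‖h.borel (Θ.Gam L) φ‖ := by
  obtain ⟨φ, hφ⟩ := h.exists_borel_ne hL hnt
  obtain ⟨⟨z, hz⟩, w, hw⟩ := exists_norm_lt_one_and_one_lt_norm
    (h.differentiable_borel (Θ.Gam L) 0 φ) (a := 1) (b := 0)
    (by rwa [one_smul, zero_smul ℂ φ, zero_add, zero_add])
  exact ⟨⟨_, hz⟩, _, hw⟩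

theorem pow_apply_expo {L : Θ.Uniform →L[ℂ] Θ.Uniform} (hL : Θ.IsConvolution L)
    (φ : E →L[ℂ] ℂ) (n : ℕ) :
    (L ^ n) (h.expo φ) = h.borel (Θ.Gam L) φ ^ n • h.expo φ := by
  induction n with
  | zero => simp
  | succ n ih =>
    rw [pow_succ, mul_apply_eq_comp, h.apply_expo hL, map_smul, ih, smul_smul,
      pow_succ']

theorem tendsto_pow_apply {L : Θ.Uniform →L[ℂ] Θ.Uniform} (hL : Θ.IsConvolution L)
    {V : Set (E →L[ℂ] ℂ)} (hV : ∀ φ ∈ V, ‖h.borel (Θ.Gam L) φ‖ < 1) {f : Θ.Uniform}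
    (hf : f ∈ h.expSpan V) : Tendsto (fun n : ℕ => (L ^ n) f) atTop (𝓝 0) := by
  induction hf using Submodule.span_induction with
  | mem f hf =>
    obtain ⟨φ, hφ, rfl⟩ := hf
    simp only [h.pow_apply_expo hL]
    simpa using (tendsto_pow_atTop_nhds_zero_of_norm_lt_one (hV φ hφ)).smul_const (h.expo φ)
  | zero => simp only [map_zero]; exact tendsto_const_nhds
  | add f g _ _ hf hg => simpa using hf.add hg
  | smul c f _ hf => simpa using hf.const_smul c

/-! ### The right inverse on the span of the exponentials. -/

/-- An induction principle for the span of the exponentials, inside this span. -/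
theorem expSpan_induction {U : Set (E →L[ℂ] ℂ)} {P : h.expSpan U → Prop}
    (expo : ∀ φ : U, P (h.expoIn U φ)) (zero : P 0) (add : ∀ f g, P f → P g → P (f + g))
    (smul : ∀ (c : ℂ) f, P f → P (c • f)) (f : h.expSpan U) : P f := by
  obtain ⟨f, hf⟩ := f
  induction hf using Submodule.span_induction with
  | mem f hf =>
    obtain ⟨φ, hφ, rfl⟩ := hf
    exact expo ⟨φ, hφ⟩
  | zero => exact zero
  | add f g hf hg h1 h2 => exact add ⟨f, hf⟩ ⟨g, hg⟩ h1 h2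
  | smul c f hf h1 => exact smul c ⟨f, hf⟩ h1

theorem expSpan_hom_ext {U : Set (E →L[ℂ] ℂ)} {M : Type*} [AddCommGroup M] [Module ℂ M]
    {S T : h.expSpan U →ₗ[ℂ] M} (hST : ∀ φ : U, S (h.expoIn U φ) = T (h.expoIn U φ)) : S = T := by
  ext f
  induction f using h.expSpan_induction with
  | expo φ => exact hST φ
  | zero => simp
  | add f g hf hg => simp [hf, hg]
  | smul c f hf => simp [hf]

/-- The restriction of a convolution operator to a span of exponentials. -/
noncomputable def restrictExpSpan {L : Θ.Uniform →L[ℂ] Θ.Uniform} (hL : Θ.IsConvolution L)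
    (U : Set (E →L[ℂ] ℂ)) : h.expSpan U →ₗ[ℂ] h.expSpan U :=
  (L : Θ.Uniform →ₗ[ℂ] Θ.Uniform).restrict (p := h.expSpan U) (q := h.expSpan U) (by
    intro f hf
    refine (Submodule.span_le (p := (h.expSpan U).comap (L : Θ.Uniform →ₗ[ℂ] Θ.Uniform))).2 ?_ hf
    rintro _ ⟨φ, hφ, rfl⟩
    change L (h.expo φ) ∈ h.expSpan U
    rw [h.apply_expo hL]
    exact (h.expSpan U).smul_mem _ (Submodule.subset_span ⟨φ, hφ, rfl⟩))

theorem restrictExpSpan_expoIn {L : Θ.Uniform →L[ℂ] Θ.Uniform} (hL : Θ.IsConvolution L)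
    (U : Set (E →L[ℂ] ℂ)) (φ : U) : h.restrictExpSpan hL U (h.expoIn U φ)
      = h.borel (Θ.Gam L) φ • h.expoIn U φ :=
  Subtype.ext (h.apply_expo hL φ.1)

/-- If the Borel transform of `Γ L` has no zero on `U`, then `L` is invertible on the span of the
exponentials `e^φ`, `φ ∈ U`. -/
theorem bijective_restrictExpSpan {L : Θ.Uniform →L[ℂ] Θ.Uniform} (hL : Θ.IsConvolution L)
    {U : Set (E →L[ℂ] ℂ)} (hU : ∀ φ ∈ U, h.borel (Θ.Gam L) φ ≠ 0) :
    Function.Bijective (h.restrictExpSpan hL U) := by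
  let A : Module.End ℂ (h.expSpan U) := h.restrictExpSpan hL U
  change Function.Bijective A
  constructor
  · rw [← LinearMap.ker_eq_bot, ← Module.End.eigenspace_zero]
    -- Eigenspaces for nonzero eigenvalues already fill the span; the kernel is the eigenspace for
    -- `0`, independent of them, so it is trivial.
    have htop : (⨆ j : ℂ, ⨆ _ : j ≠ 0, A.eigenspace j) = ⊤ := by
      refine eq_top_iff.2 fun f _ => ?_
      induction f using h.expSpan_induction with
      | expo φ =>
        refine Submodule.mem_iSup_of_mem (h.borel (Θ.Gam L) φ)
          (Submodule.mem_iSup_of_mem (hU φ.1 φ.2) ?_)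
        exact Module.End.mem_eigenspace_iff.2 (h.restrictExpSpan_expoIn hL U φ)
      | zero => exact zero_mem _
      | add f g hf hg => exact add_mem (hf trivial) (hg trivial)
      | smul c f hf => exact Submodule.smul_mem _ c (hf trivial)
    have hi := A.eigenspaces_iSupIndep 0
    rw [htop] at hi
    exact disjoint_top.1 hi
  · intro f
    induction f using h.expSpan_induction with
    | expo φ =>
      refine ⟨(h.borel (Θ.Gam L) φ)⁻¹ • h.expoIn U φ, ?_⟩
      rw [map_smul]
      refine (congrArg _ (h.restrictExpSpan_expoIn hL U φ)).trans ?_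
      rw [smul_smul, inv_mul_cancel₀ (hU φ.1 φ.2), one_smul]
    | zero => exact ⟨0, map_zero A⟩
    | add f g hf hg =>
      obtain ⟨a, rfl⟩ := hf
      obtain ⟨b, rfl⟩ := hg
      exact ⟨a + b, map_add A a b⟩
    | smul c f hf =>
      obtain ⟨a, rfl⟩ := hf
      exact ⟨c • a, map_smul A c a⟩

/-- Taking the inverse of the restricted `L` shows that the prescribed values on exponentials are
consistent, even though these are only known to span. -/
theorem existsUnique_rightInverse {L : Θ.Uniform →L[ℂ] Θ.Uniform} (hL : Θ.IsConvolution L)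
    {U : Set (E →L[ℂ] ℂ)} (hU : ∀ φ ∈ U, h.borel (Θ.Gam L) φ ≠ 0) :
    ∃! S : h.expSpan U →ₗ[ℂ] h.expSpan U,
      ∀ φ : U, S (h.expoIn U φ) = (h.borel (Θ.Gam L) φ)⁻¹ • h.expoIn U φ := by
  let e := LinearEquiv.ofBijective _ (h.bijective_restrictExpSpan hL hU)
  refine ⟨e.symm, fun φ => ?_, fun S hS => h.expSpan_hom_ext fun φ => ?_⟩
  all_goals
    have he : e.symm (h.expoIn U φ) = (h.borel (Θ.Gam L) φ)⁻¹ • h.expoIn U φ := by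
      rw [LinearEquiv.symm_apply_eq, map_smul]
      refine (?_ : _ = (h.borel (Θ.Gam L) φ)⁻¹ • h.restrictExpSpan hL U (h.expoIn U φ))
      rw [h.restrictExpSpan_expoIn, smul_smul, inv_mul_cancel₀ (hU φ.1 φ.2), one_smul]
  · exact he
  · exact (hS φ).trans he.symm

theorem tendsto_pow_rightInverse {U : Set (E →L[ℂ] ℂ)} {b : (E →L[ℂ] ℂ) → ℂ}
    (hb : ∀ φ ∈ U, 1 < ‖b φ‖) {S : h.expSpan U →ₗ[ℂ] h.expSpan U}
    (hS : ∀ φ : U, S (h.expoIn U φ) = (b φ)⁻¹ • h.expoIn U φ) (f : h.expSpan U) :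
    Tendsto (fun n : ℕ => (S ^ n) f) atTop (𝓝 0) := by
  induction f using h.expSpan_induction with
  | expo φ =>
    have hpow : ∀ n : ℕ, (S ^ n) (h.expoIn U φ) = (b φ)⁻¹ ^ n • h.expoIn U φ := by
      intro n
      induction n with
      | zero => simp
      | succ n ih => rw [pow_succ, Module.End.mul_apply, hS, map_smul, ih, smul_smul, pow_succ']
    have hlt : ‖(b φ)⁻¹‖ < 1 := by
      rw [norm_inv]
      exact inv_lt_one_of_one_lt₀ (hb φ.1 φ.2)
    simp only [hpow]
    simpa using (tendsto_pow_atTop_nhds_zero_of_norm_lt_one hlt).smul_const (h.expoIn U φ)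
  | zero => simp only [map_zero]; exact tendsto_const_nhds
  | add f g hf hg => simpa using hf.add hg
  | smul c f hf => simpa using hf.const_smul c

/-- The factors `b(φ)` and `b(φ)⁻¹` cancel on each exponential, and exponentials span. -/
theorem apply_rightInverse {L : Θ.Uniform →L[ℂ] Θ.Uniform} (hL : Θ.IsConvolution L)
    {U : Set (E →L[ℂ] ℂ)} (hU : ∀ φ ∈ U, h.borel (Θ.Gam L) φ ≠ 0)
    {S : h.expSpan U →ₗ[ℂ] h.expSpan U}
    (hS : ∀ φ : U, S (h.expoIn U φ) = (h.borel (Θ.Gam L) φ)⁻¹ • h.expoIn U φ)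
    (f : h.expSpan U) : L (S f) = (f : Θ.Uniform) := by
  have hc : (h.restrictExpSpan hL U).comp S = LinearMap.id := h.expSpan_hom_ext fun φ => by
    rw [LinearMap.comp_apply, hS, map_smul, h.restrictExpSpan_expoIn, smul_smul,
      inv_mul_cancel₀ (hU φ.1 φ.2), one_smul, LinearMap.id_apply]
  exact congrArg Subtype.val (LinearMap.congr_fun hc f)

end HasPi1Family

end HolomorphySystem

end LocallyConvex

end UniformHolo

theorem mainTheorem4 {E : Type*} [AddCommGroup E] [Module ℂ E] [TopologicalSpace E]
    [IsTopologicalAddGroup E] [ContinuousSMul ℂ E] [LocallyConvexSpace ℝ E] [T2Space E]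
    (Θ : UniformHolo.HolomorphySystem E) (hΘ : Θ.HasPi1Family)
    (L : Θ.Uniform →L[ℂ] Θ.Uniform) (hL : Θ.IsConvolution L)
    (hnt : ¬ ∃ c : ℂ, L = c • ContinuousLinearMap.id ℂ Θ.Uniform)
    (V W : Set (E →L[ℂ] ℂ))
    (hV : V = {φ | ‖hΘ.borel (Θ.Gam L) φ‖ < 1})
    (hW : W = {φ | 1 < ‖hΘ.borel (Θ.Gam L) φ‖}) :
    (Dense (hΘ.expSpan V : Set Θ.Uniform) ∧ Dense (hΘ.expSpan W : Set Θ.Uniform)) ∧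
    (∀ f ∈ hΘ.expSpan V, Tendsto (fun n : ℕ => (L ^ n) f) atTop (𝓝 0)) ∧
    (∃! S : hΘ.expSpan W →ₗ[ℂ] hΘ.expSpan W,
      ∀ φ : W, S (hΘ.expoIn W φ) = (hΘ.borel (Θ.Gam L) φ)⁻¹ • hΘ.expoIn W φ) ∧
    (∀ S : hΘ.expSpan W →ₗ[ℂ] hΘ.expSpan W,
      (∀ φ : W, S (hΘ.expoIn W φ) = (hΘ.borel (Θ.Gam L) φ)⁻¹ • hΘ.expoIn W φ) →
        (∀ f : hΘ.expSpan W, Tendsto (fun n : ℕ => (S ^ n) f) atTop (𝓝 0)) ∧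
        (∀ f : hΘ.expSpan W, L (S f) = (f : Θ.Uniform))) := by
  subst hV hW
  obtain ⟨hVne, hWne⟩ := hΘ.exists_borel_lt_and_gt hL hnt
  have hne : ∀ φ ∈ {φ | 1 < ‖hΘ.borel (Θ.Gam L) φ‖}, hΘ.borel (Θ.Gam L) φ ≠ 0 :=
    fun φ hφ => norm_pos_iff.1 (one_pos.trans hφ)
  refine ⟨⟨hΘ.dense_expSpan hVne fun φ hφ ψ => ?_, hΘ.dense_expSpan hWne fun φ hφ ψ => ?_⟩,
    fun f hf => hΘ.tendsto_pow_apply hL (fun _ hφ => hφ) hf, hΘ.existsUnique_rightInverse hL hne,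
    fun S hS => ⟨hΘ.tendsto_pow_rightInverse (b := hΘ.borel (Θ.Gam L)) (fun _ hφ => hφ) hS,
      hΘ.apply_rightInverse hL hne hS⟩⟩
  · exact hΘ.eventually_borel_mem (Θ.Gam L) (S := {w | ‖w‖ < 1})
      (isOpen_lt continuous_norm continuous_const) φ hφ ψ
  · exact hΘ.eventually_borel_mem (Θ.Gam L) (S := {w | 1 < ‖w‖})
      (isOpen_lt continuous_const continuous_norm) φ hφ ψ
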